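/- **Theorem (A divisor theoretic characterization of normalizing Krull monoids).** A *monoid* is a cancellative semigroup $H$ with unit element such that $aH\cap bH\ne\emptyset$ and $Ha\cap Hb\ne\emptyset$ for all $a,b\in H$; let $\mathsf q(H)$ be its quotient group, and $(A:_lB)=\{x\in \mathsf q(H): xB\subset A\}$, $(A:_rB)=\{x\in \mathsf q(H): Bx\subset A\}$ for $A,B\subset \mathsf q(H)$. A *fractional ideal* is a (possibly empty) set $A\subset\mathsf q(H)$ with $HA=A=AH$ such that $Aa\subset H$ and $bA\subset H$ for some $a,b\in H$; it is an *ideal* if $A\subset H$. A *$v$-ideal* is an ideal $A$ with $A=(H:_l(H:_rA))=(H:_r(H:_lA))$. If $(H:_lC)=(H:_rC)=:C^{-1}$ for all fractional ideals $C$, then, with $C_v=(C^{-1})^{-1}$, $\mathcal I_v^*(H)$ denotes the monoid of all $v$-ideals $A$ that are $v$-invertible, i.e. satisfy $(AA^{-1})_v=(A^{-1}A)_v=H$; its product is $A\cdot_vB=(AB)_v$ and its unit element is $H$. $H$ is *normalizing* if $aH=Ha$ for all $a\in H$. $H$ is a *Krull monoid* if it satisfies the ascending chain condition on $v$-ideals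 and is completely integrally closed, i.e. there is no submonoid $H'$ of $\mathsf q(H)$ with $H\subsetneq H'$ and $aH'b\subset H$ for some $a,b\in H$. A *divisor homomorphism* is a (unit preserving) homomorphism $\varphi\colon H\to D$ of monoids such that, for all $u,v\in H$, $\varphi(v)\in\varphi(u)D$ implies $v\in uH$, and $\varphi(v)\in D\varphi(u)$ implies $v\in Hu$. A *divisor theory* for $H$ is a divisor homomorphism $\varphi\colon H\to D$ into a free abelian monoid $D=\mathcal F(P)$ with basis $P$ such that every $p\in P$ is the greatest common divisor of $\varphi(X)$ for some finite non-empty set $X\subset H$. Let $H$ be a monoid. Then the following statements are equivalent: (a) $(H:_lC)=(H:_rC)$ for all fractional ideals $C$ of $H$ (so that $\mathcal I_v^*(H)$ is defined), and $\partial\colon H\to\mathcal I_v^*(H)$, $\partial(a)=aH$ for all $a\in H$, is a well-defined map and a divisor theory. (b) $H$ has a divisor theory. (c) There exists a divisor homomorphism $\varphi\colon H\to\mathcal F(P)$ into a free abelian monoid, for some set $P$. (d) $H$ is a normalizing Krull monoid. -/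

import Mathlib

open scoped Pointwise

universe u v

namespace KrullMonoid

/-! ### Monoids (cancellative semigroups with `1` and both Ore conditions), quotient groups -/

/-- The left and the right Ore condition: `Ha ∩ Hb ≠ ∅` and `aH ∩ bH ≠ ∅` for all `a, b ∈ H`. -/
class IsOre (H : Type u) [Monoid H] : Prop where
  left_ore : ∀ a b : H, ∃ c d : H, c * a = d * b
  right_ore : ∀ a b : H, ∃ c d : H, a * c = b * d

section Quotient

variable (H : Type u) [CancelMonoid H] [IsOre H]

noncomputable instance oreSetTop : OreLocalization.OreSet (⊤ : Submonoid H) where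
  ore_right_cancel r₁ r₂ s h := ⟨1, by rw [mul_right_cancel h]⟩
  oreNum r s := (IsOre.left_ore r (s : H)).choose_spec.choose
  oreDenom r s := ⟨(IsOre.left_ore r (s : H)).choose, trivial⟩
  ore_eq r s := (IsOre.left_ore r (s : H)).choose_spec.choose_spec

/-- The quotient group `q(H)`: the localization of `H` at all its elements. -/
def QuotientGrp : Type u := OreLocalization (⊤ : Submonoid H) H

noncomputable instance instMonoidQuotientGrp : Monoid (QuotientGrp H) :=
  inferInstanceAs (Monoid (OreLocalization (⊤ : Submonoid H) H))

/-- The embedding `H → q(H)`. -/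
noncomputable def toQ : H →* QuotientGrp H :=
  (OreLocalization.numeratorHom : H →* OreLocalization (⊤ : Submonoid H) H)

theorem isUnit_toQ (a : H) : IsUnit (toQ H a) :=
  OreLocalization.numerator_isUnit (⟨a, trivial⟩ : (⊤ : Submonoid H))

theorem exists_toQ_mul_eq (x : QuotientGrp H) : ∃ a b : H, toQ H a * x = toQ H b := by
  have key : ∀ y : OreLocalization (⊤ : Submonoid H) H, ∃ a b : H,
      (OreLocalization.numeratorHom a : OreLocalization (⊤ : Submonoid H) H) * y
        = OreLocalization.numeratorHom b := by
    intro y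
    induction y with
    | _ r s =>
      exact ⟨s, r, OreLocalization.mul_cancel (r := r) (s := s) (t := 1)⟩
  exact key x

theorem isUnit_quotientGrp (x : QuotientGrp H) : IsUnit x := by
  obtain ⟨a, b, h⟩ := exists_toQ_mul_eq H x
  obtain ⟨ua, hua⟩ := isUnit_toQ H a
  have hx : x = ↑ua⁻¹ * toQ H b := by rw [← h, ← hua, Units.inv_mul_cancel_left]
  rw [hx]
  exact (Units.isUnit _).mul (isUnit_toQ H b)

noncomputable instance instGroupQuotientGrp : Group (QuotientGrp H) :=
  { instMonoidQuotientGrp H with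
    inv := fun x => ↑(isUnit_quotientGrp H x).unit⁻¹
    inv_mul_cancel := fun x => (isUnit_quotientGrp H x).val_inv_mul }

theorem toQ_injective : Function.Injective (toQ H) := by
  intro a b h
  have h' : (OreLocalization.oreDiv a (1 : (⊤ : Submonoid H))) = OreLocalization.oreDiv b 1 := h
  rw [OreLocalization.oreDiv_eq_iff] at h'
  obtain ⟨s, t, h1, h2⟩ := h'
  have hst : (s : H) = t := by simpa using h2
  have h3 : (s : H) * b = t * a := h1
  rw [hst] at h3
  exact (mul_left_cancel h3).symm

/-- Every element of `q(H)` is a left fraction `a⁻¹b` with `a, b ∈ H`. -/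
theorem exists_left_fraction (x : QuotientGrp H) : ∃ a b : H, x = (toQ H a)⁻¹ * toQ H b := by
  obtain ⟨a, b, h⟩ := exists_toQ_mul_eq H x
  exact ⟨a, b, by rw [← h, inv_mul_cancel_left]⟩

/-- Every element of `q(H)` is a right fraction `ba⁻¹` with `a, b ∈ H`. -/
theorem exists_right_fraction (x : QuotientGrp H) : ∃ a b : H, x = toQ H b * (toQ H a)⁻¹ := by
  obtain ⟨a, b, rfl⟩ := exists_left_fraction H x
  obtain ⟨c, d, h⟩ := IsOre.right_ore a b
  refine ⟨d, c, ?_⟩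
  have h' : toQ H a * toQ H c = toQ H b * toQ H d := by rw [← map_mul, ← map_mul, h]
  rw [eq_mul_inv_iff_mul_eq, mul_assoc, ← h', inv_mul_cancel_left]

/-- `H`, regarded as a submonoid of `q(H)`. -/
noncomputable def inQ : Submonoid (QuotientGrp H) := MonoidHom.mrange (toQ H)

end Quotient

/-! ### Ideal theory of a submonoid `S` of a group `Q` (used for `S = H`, `Q = q(H)`) -/

section Ideals

variable {Q : Type u} [Group Q]

/-- The left quotient `(A :ₗ B) = {x ∈ Q ∣ xB ⊆ A}`. -/
def lquot (A B : Set Q) : Set Q := {x | ∀ b ∈ B, x * b ∈ A}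

/-- The right quotient `(A :ᵣ B) = {x ∈ Q ∣ Bx ⊆ A}`. -/
def rquot (A B : Set Q) : Set Q := {x | ∀ b ∈ B, b * x ∈ A}

variable (S : Submonoid Q)

/-- Left fractional: `Aa ⊆ S` for some `a ∈ S`. -/
def IsLeftFractional (A : Set Q) : Prop := ∃ a ∈ S, ∀ x ∈ A, x * a ∈ S

/-- Right fractional: `aA ⊆ S` for some `a ∈ S`. -/
def IsRightFractional (A : Set Q) : Prop := ∃ a ∈ S, ∀ x ∈ A, a * x ∈ S

/-- (Two-sided) fractional ideals; the empty set is one of them. -/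
structure IsFractionalIdeal (A : Set Q) : Prop where
  left_module : (S : Set Q) * A = A
  right_module : A * (S : Set Q) = A
  left_fractional : IsLeftFractional S A
  right_fractional : IsRightFractional S A

/-- (Two-sided) ideals: fractional ideals contained in `S`. -/
def IsIdeal (A : Set Q) : Prop := IsFractionalIdeal S A ∧ A ⊆ S

/-- The set `(S :ₗ (S :ᵣ A))`, which is `A_v` whenever it coincides with `(S :ᵣ (S :ₗ A))`. -/
def vclosure (A : Set Q) : Set Q := lquot S (rquot S A)

/-- Divisorial ideals (`v`-ideals) of `S`: ideals `A` for which the two closures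
`(S :ₗ (S :ᵣ A))` and `(S :ᵣ (S :ₗ A))` coincide and are equal to `A`. -/
structure IsVIdeal (A : Set Q) : Prop where
  isIdeal : IsIdeal S A
  left_divisorial : lquot S (rquot S A) = A
  right_divisorial : rquot S (lquot S A) = A

/-- The standing condition under which `v`-multiplication is defined:
`(S :ₗ C) = (S :ᵣ C)` for all fractional ideals `C`. -/
def SymmetricQuotients : Prop :=
  ∀ C : Set Q, IsFractionalIdeal S C → lquot (S : Set Q) C = rquot S C

/-- `v`-invertible: `(A A⁻¹)_v = (A⁻¹ A)_v = S`, where `A⁻¹ = (S :ₗ A)`. -/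
def IsVInvertible (A : Set Q) : Prop :=
  vclosure S (A * lquot S A) = S ∧ vclosure S (lquot S A * A) = S

/-- `I_v^*(S)`, the set of `v`-invertible `v`-ideals; it is only defined (and only formed)
under the condition `SymmetricQuotients S`. -/
@[ext] structure IvStar (hS : SymmetricQuotients S) where
  carrier : Set Q
  isVIdeal : IsVIdeal S carrier
  isVInvertible : IsVInvertible S carrier

/-! Facts needed for the `v`-multiplication on `I_v^*(S)` -/

variable {S}

theorem IsIdeal.mul_mem_left {A : Set Q} (hA : IsIdeal S A) {s a : Q} (hs : s ∈ S) (ha : a ∈ A) :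
    s * a ∈ A := by
  rw [← hA.1.left_module]; exact Set.mul_mem_mul hs ha

theorem IsIdeal.mul_mem_right {A : Set Q} (hA : IsIdeal S A) {s a : Q} (ha : a ∈ A) (hs : s ∈ S) :
    a * s ∈ A := by
  rw [← hA.1.right_module]; exact Set.mul_mem_mul ha hs

theorem isIdeal_of {A : Set Q} (hsub : A ⊆ S) (hl : ∀ s ∈ S, ∀ a ∈ A, s * a ∈ A)
    (hr : ∀ s ∈ S, ∀ a ∈ A, a * s ∈ A) : IsIdeal S A := by
  refine ⟨⟨?_, ?_, ⟨1, S.one_mem, fun x hx => by simpa using hsub hx⟩,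
    ⟨1, S.one_mem, fun x hx => by simpa using hsub hx⟩⟩, hsub⟩
  · apply Set.Subset.antisymm
    · rintro _ ⟨s, hs, a, ha, rfl⟩
      exact hl s hs a ha
    · intro a ha
      exact ⟨1, S.one_mem, a, ha, one_mul a⟩
  · apply Set.Subset.antisymm
    · rintro _ ⟨a, ha, s, hs, rfl⟩
      exact hr s hs a ha
    · intro a ha
      exact ⟨a, ha, 1, S.one_mem, mul_one a⟩

theorem isIdeal_mul {A B : Set Q} (hA : IsIdeal S A) (hB : IsIdeal S B) : IsIdeal S (A * B) := by
  refine isIdeal_of ?_ ?_ ?_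
  · rintro _ ⟨a, ha, b, hb, rfl⟩
    exact S.mul_mem (hA.2 ha) (hB.2 hb)
  · rintro s hs _ ⟨a, ha, b, hb, rfl⟩
    exact ⟨s * a, hA.mul_mem_left hs ha, b, hb, mul_assoc _ _ _⟩
  · rintro s hs _ ⟨a, ha, b, hb, rfl⟩
    exact ⟨a, ha, b * s, hB.mul_mem_right hb hs, (mul_assoc _ _ _).symm⟩

theorem subset_vclosure (A : Set Q) : A ⊆ vclosure S A := fun a ha _ hx => hx a ha

theorem rquot_vclosure (A : Set Q) : rquot (S : Set Q) (vclosure S A) = rquot S A := by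
  apply Set.Subset.antisymm
  · intro x hx a ha
    exact hx a (subset_vclosure A ha)
  · intro x hx y hy
    exact hy x hx

theorem vclosure_eq_of_rquot_eq {A B : Set Q} (h : rquot (S : Set Q) A = rquot S B) :
    vclosure S A = vclosure S B := by
  unfold vclosure; rw [h]

theorem vclosure_vclosure (A : Set Q) : vclosure S (vclosure S A) = vclosure S A :=
  vclosure_eq_of_rquot_eq (rquot_vclosure A)

theorem rquot_self : rquot (S : Set Q) S = S := by
  apply Set.Subset.antisymm
  · intro x hx
    simpa using hx 1 S.one_mem
  · intro x hx b hb
    exact S.mul_mem hb hx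

theorem lquot_self : lquot (S : Set Q) S = S := by
  apply Set.Subset.antisymm
  · intro x hx
    simpa using hx 1 S.one_mem
  · intro x hx b hb
    exact S.mul_mem hx hb

theorem vclosure_self : vclosure S (S : Set Q) = S := by
  unfold vclosure; rw [rquot_self, lquot_self]

theorem vclosure_subset {A : Set Q} (hA : A ⊆ S) : vclosure S A ⊆ S := by
  intro x hx
  have : (1 : Q) ∈ rquot (S : Set Q) A := fun a ha => by simpa using hA ha
  simpa using hx 1 this

theorem vclosure_eq_self_iff {A : Set Q} (hA : A ⊆ S) :
    vclosure S A = S ↔ rquot (S : Set Q) A ⊆ S := by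
  constructor
  · intro h x hx
    rw [← rquot_vclosure, h, rquot_self] at hx
    exact hx
  · intro h
    refine Set.Subset.antisymm (vclosure_subset hA) ?_
    intro s hs x hx
    exact S.mul_mem hs (h hx)

theorem isIdeal_self : IsIdeal S (S : Set Q) :=
  isIdeal_of subset_rfl (fun _ hs _ ha => S.mul_mem hs ha) (fun _ hs _ ha => S.mul_mem ha hs)

theorem isFractionalIdeal_lquot (hS : SymmetricQuotients S) {A : Set Q} (hA : IsIdeal S A)
    (hne : A.Nonempty) : IsFractionalIdeal S (lquot (S : Set Q) A) := by
  obtain ⟨a, ha⟩ := hne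
  have hsym := hS A hA.1
  refine ⟨?_, ?_, ⟨a, hA.2 ha, fun x hx => hx a ha⟩, ⟨a, hA.2 ha, fun x hx => ?_⟩⟩
  · apply Set.Subset.antisymm
    · rintro _ ⟨s, hs, x, hx, rfl⟩ b hb
      rw [mul_assoc]
      exact S.mul_mem hs (hx b hb)
    · intro x hx
      exact ⟨1, S.one_mem, x, hx, one_mul x⟩
  · apply Set.Subset.antisymm
    · rintro _ ⟨x, hx, s, hs, rfl⟩ b hb
      rw [mul_assoc]
      exact hx _ (hA.mul_mem_left hs hb)
    · intro x hx
      exact ⟨x, hx, 1, S.one_mem, mul_one x⟩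
  · rw [hsym] at hx
    exact hx a ha

/-- For non-empty ideals the two closures coincide. -/
theorem vclosure_eq (hS : SymmetricQuotients S) {A : Set Q} (hA : IsIdeal S A)
    (hne : A.Nonempty) : vclosure S A = rquot (S : Set Q) (lquot S A) := by
  unfold vclosure
  rw [← hS A hA.1, hS _ (isFractionalIdeal_lquot hS hA hne)]

theorem isVIdeal_vclosure (hS : SymmetricQuotients S) {A : Set Q} (hA : IsIdeal S A)
    (hne : A.Nonempty) : IsVIdeal S (vclosure S A) := by
  have hid : IsIdeal S (vclosure S A) := by
    refine isIdeal_of (vclosure_subset hA.2) ?_ ?_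
    · intro s hs x hx y hy
      rw [mul_assoc]
      exact S.mul_mem hs (hx y hy)
    · intro s hs x hx
      rw [vclosure_eq hS hA hne] at hx ⊢
      intro y hy
      rw [← mul_assoc]
      exact S.mul_mem (hx y hy) hs
  refine ⟨hid, vclosure_vclosure A, ?_⟩
  rw [← vclosure_eq hS hid (hne.mono (subset_vclosure A)), vclosure_vclosure]

theorem rquot_vclosure_mul (A B : Set Q) :
    rquot (S : Set Q) (vclosure S A * B) = rquot S (A * B) := by
  apply Set.Subset.antisymm
  · rintro x hx _ ⟨a, ha, b, hb, rfl⟩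
    exact hx _ ⟨a, subset_vclosure A ha, b, hb, rfl⟩
  · rintro x hx _ ⟨a, ha, b, hb, rfl⟩
    show a * b * x ∈ S
    rw [mul_assoc]
    exact ha _ (fun a' ha' => by
      rw [← mul_assoc]
      exact hx _ ⟨a', ha', b, hb, rfl⟩)

theorem rquot_mul_vclosure (hS : SymmetricQuotients S) {A B : Set Q} (hA : IsIdeal S A)
    (hB : IsIdeal S B) (hne : B.Nonempty) :
    rquot (S : Set Q) (A * vclosure S B) = rquot S (A * B) := by
  apply Set.Subset.antisymm
  · rintro x hx _ ⟨a, ha, b, hb, rfl⟩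
    exact hx _ ⟨a, ha, b, subset_vclosure B hb, rfl⟩
  · rw [← hS _ (isIdeal_mul hA hB).1,
      ← hS _ (isIdeal_mul hA (isVIdeal_vclosure hS hB hne).isIdeal).1]
    rintro x hx _ ⟨a, ha, b, hb, rfl⟩
    rw [vclosure_eq hS hB hne] at hb
    show x * (a * b) ∈ S
    rw [← mul_assoc]
    refine hb _ (fun b' hb' => ?_)
    rw [mul_assoc]
    exact hx _ ⟨a, ha, b', hb', rfl⟩

theorem vclosure_mul_assoc (hS : SymmetricQuotients S) {A B C : Set Q} (hA : IsIdeal S A)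
    (hB : IsIdeal S B) (hC : IsIdeal S C) (hBC : (B * C).Nonempty) :
    vclosure S (vclosure S (A * B) * C) = vclosure S (A * vclosure S (B * C)) := by
  apply vclosure_eq_of_rquot_eq
  rw [rquot_vclosure_mul, rquot_mul_vclosure hS hA (isIdeal_mul hB hC) hBC, mul_assoc]

theorem IsVInvertible.nonempty {A : Set Q} (hv : IsVIdeal S A) (hi : IsVInvertible S A) :
    A.Nonempty := by
  by_contra hne
  rw [Set.not_nonempty_iff_eq_empty] at hne
  subst hne
  have h1 := hi.1
  rw [Set.empty_mul] at h1
  have h2 : vclosure S (∅ : Set Q) = ∅ := hv.left_divisorial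
  rw [h2] at h1
  exact Set.notMem_empty (1 : Q) (by rw [h1]; exact S.one_mem)

theorem mul_lquot_subset (hS : SymmetricQuotients S) {A : Set Q} (hA : IsIdeal S A) :
    A * lquot (S : Set Q) A ⊆ S := by
  rintro _ ⟨a, ha, x, hx, rfl⟩
  rw [hS A hA.1] at hx
  exact hx a ha

theorem lquot_mul_subset (A : Set Q) : lquot (S : Set Q) A * A ⊆ S := by
  rintro _ ⟨x, hx, a, ha, rfl⟩
  exact hx a ha

theorem isIdeal_mul_lquot (hS : SymmetricQuotients S) {A : Set Q} (hA : IsIdeal S A)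
    (hne : A.Nonempty) : IsIdeal S (A * lquot (S : Set Q) A) := by
  have hI := isFractionalIdeal_lquot hS hA hne
  refine isIdeal_of (mul_lquot_subset hS hA) ?_ ?_
  · rintro s hs _ ⟨a, ha, b, hb, rfl⟩
    exact ⟨s * a, hA.mul_mem_left hs ha, b, hb, mul_assoc _ _ _⟩
  · rintro s hs _ ⟨a, ha, b, hb, rfl⟩
    refine ⟨a, ha, b * s, ?_, (mul_assoc _ _ _).symm⟩
    rw [← hI.right_module]
    exact Set.mul_mem_mul hb hs

theorem isIdeal_lquot_mul (hS : SymmetricQuotients S) {A : Set Q} (hA : IsIdeal S A)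
    (hne : A.Nonempty) : IsIdeal S (lquot (S : Set Q) A * A) := by
  have hI := isFractionalIdeal_lquot hS hA hne
  refine isIdeal_of (lquot_mul_subset A) ?_ ?_
  · rintro s hs _ ⟨b, hb, a, ha, rfl⟩
    refine ⟨s * b, ?_, a, ha, mul_assoc _ _ _⟩
    rw [← hI.left_module]
    exact Set.mul_mem_mul hs hb
  · rintro s hs _ ⟨b, hb, a, ha, rfl⟩
    exact ⟨b, hb, a * s, hA.mul_mem_right ha hs, (mul_assoc _ _ _).symm⟩

theorem isFractionalIdeal_mul {X I : Set Q} (hX : IsFractionalIdeal S X) (hI : IsIdeal S I) :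
    IsFractionalIdeal S (X * I) := by
  have hsub : X * I ⊆ X := by
    rintro _ ⟨x, hx, i, hi, rfl⟩
    rw [← hX.right_module]
    exact Set.mul_mem_mul hx (hI.2 hi)
  obtain ⟨a, ha, hXa⟩ := hX.left_fractional
  obtain ⟨b, hb, hXb⟩ := hX.right_fractional
  refine ⟨?_, ?_, ⟨a, ha, fun x hx => hXa x (hsub hx)⟩, ⟨b, hb, fun x hx => hXb x (hsub hx)⟩⟩
  · rw [← mul_assoc, hX.left_module]
  · rw [mul_assoc, hI.1.right_module]

theorem lquot_vclosure (hS : SymmetricQuotients S) {A : Set Q} (hA : IsIdeal S A)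
    (hne : A.Nonempty) : lquot (S : Set Q) (vclosure S A) = lquot S A := by
  rw [hS _ (isVIdeal_vclosure hS hA hne).isIdeal.1, rquot_vclosure, hS _ hA.1]

/-- The `v`-product of `v`-invertible `v`-ideals is `v`-invertible. -/
theorem isVInvertible_mul (hS : SymmetricQuotients S) {A B : Set Q} (hA : IsVIdeal S A)
    (hB : IsVIdeal S B) (hA' : IsVInvertible S A) (hB' : IsVInvertible S B) :
    IsVInvertible S (vclosure S (A * B)) := by
  have hAn := hA'.nonempty hA
  have hBn := hB'.nonempty hB
  have hAB := isIdeal_mul hA.isIdeal hB.isIdeal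
  have hABn : (A * B).Nonempty := hAn.mul hBn
  have hV := (isVIdeal_vclosure hS hAB hABn).isIdeal
  have hVn : (vclosure S (A * B)).Nonempty := hABn.mono (subset_vclosure _)
  have hprod : ∀ x ∈ lquot (S : Set Q) B, ∀ y ∈ lquot (S : Set Q) A,
      x * y ∈ lquot (S : Set Q) (A * B) := by
    rintro x hx y hy _ ⟨a, ha, b, hb, rfl⟩
    have : x * y * (a * b) = x * ((y * a) * b) := by group
    show x * y * (a * b) ∈ S
    rw [this]
    exact hx _ (hB.isIdeal.mul_mem_left (hy a ha) hb)
  constructor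
  · rw [vclosure_eq_self_iff (mul_lquot_subset hS hV), lquot_vclosure hS hAB hABn]
    intro z hz
    refine (vclosure_eq_self_iff (mul_lquot_subset hS hA.isIdeal)).1 hA'.1 ?_
    rintro _ ⟨a, ha, y, hy, rfl⟩
    have hI := isIdeal_mul_lquot hS hB.isIdeal hBn
    have hAI := isIdeal_mul hA.isIdeal hI
    have h1 : y * z ∈ rquot (S : Set Q) (A * (B * lquot (S : Set Q) B)) := by
      rintro _ ⟨a', ha', _, ⟨b, hb, x, hx, rfl⟩, rfl⟩
      have : a' * (b * x) * (y * z) = (a' * b) * (x * y) * z := by group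
      show a' * (b * x) * (y * z) ∈ S
      rw [this]
      exact hz _ ⟨a' * b, subset_vclosure _ ⟨a', ha', b, hb, rfl⟩, x * y, hprod x hx y hy, rfl⟩
    rw [← hS _ hAI.1] at h1
    have h2 : y * z ∈ lquot (S : Set Q) A := by
      intro a' ha'
      refine (vclosure_eq_self_iff (mul_lquot_subset hS hB.isIdeal)).1 hB'.1 ?_
      rw [← hS _ hI.1]
      intro i hi
      rw [mul_assoc]
      exact h1 _ ⟨a', ha', i, hi, rfl⟩
    rw [hS _ hA.isIdeal.1] at h2
    show a * y * z ∈ S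
    rw [mul_assoc]
    exact h2 a ha
  · rw [vclosure_eq_self_iff (lquot_mul_subset _), lquot_vclosure hS hAB hABn]
    intro z hz
    refine (vclosure_eq_self_iff (lquot_mul_subset B)).1 hB'.2 ?_
    rintro _ ⟨x, hx, b, hb, rfl⟩
    have hX := isFractionalIdeal_lquot hS hB.isIdeal hBn
    have hI := isIdeal_lquot_mul hS hA.isIdeal hAn
    have hXI := isFractionalIdeal_mul hX hI
    have h1 : b * z ∈ rquot (S : Set Q) (lquot (S : Set Q) B * (lquot (S : Set Q) A * A)) := by
      rintro _ ⟨x', hx', _, ⟨y, hy, a, ha, rfl⟩, rfl⟩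
      have : x' * (y * a) * (b * z) = (x' * y) * (a * b) * z := by group
      show x' * (y * a) * (b * z) ∈ S
      rw [this]
      exact hz _ ⟨x' * y, hprod x' hx' y hy, a * b, subset_vclosure _ ⟨a, ha, b, hb, rfl⟩, rfl⟩
    rw [← hS _ hXI] at h1
    have h2 : b * z ∈ lquot (S : Set Q) (lquot (S : Set Q) B) := by
      intro x' hx'
      refine (vclosure_eq_self_iff (lquot_mul_subset A)).1 hA'.2 ?_
      rw [← hS _ hI.1]
      intro i hi
      rw [mul_assoc]
      exact h1 _ ⟨x', hx', i, hi, rfl⟩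
    rw [hS _ hX] at h2
    show x * b * z ∈ S
    rw [mul_assoc]
    exact h2 x hx

/-- `I_v^*(S)` is a monoid: the product is the `v`-product `(AB)_v`, the unit element is `S`. -/
instance instMonoidIvStar (hS : SymmetricQuotients S) : Monoid (IvStar S hS) where
  mul A B :=
    { carrier := vclosure S (A.carrier * B.carrier)
      isVIdeal := isVIdeal_vclosure hS (isIdeal_mul A.isVIdeal.isIdeal B.isVIdeal.isIdeal)
        ((A.isVInvertible.nonempty A.isVIdeal).mul (B.isVInvertible.nonempty B.isVIdeal))
      isVInvertible := isVInvertible_mul hS A.isVIdeal B.isVIdeal A.isVInvertible B.isVInvertible }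
  one :=
    { carrier := S
      isVIdeal := ⟨isIdeal_self, vclosure_self, by rw [lquot_self, rquot_self]⟩
      isVInvertible := by
        constructor <;> rw [lquot_self, Submonoid.coe_mul_self_eq, vclosure_self] }
  mul_assoc A B C := IvStar.ext (vclosure_mul_assoc hS A.isVIdeal.isIdeal B.isVIdeal.isIdeal
    C.isVIdeal.isIdeal
    ((B.isVInvertible.nonempty B.isVIdeal).mul (C.isVInvertible.nonempty C.isVIdeal)))
  one_mul A := IvStar.ext (by
    show vclosure S ((S : Set Q) * A.carrier) = A.carrier
    rw [A.isVIdeal.isIdeal.1.left_module]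
    exact A.isVIdeal.left_divisorial)
  mul_one A := IvStar.ext (by
    show vclosure S (A.carrier * (S : Set Q)) = A.carrier
    rw [A.isVIdeal.isIdeal.1.right_module]
    exact A.isVIdeal.left_divisorial)

variable (S)

/-- Completely integrally closed: `S` has no proper overmonoid `T` (inside `Q`) such that
`aTb ⊆ S` for some `a, b ∈ S`. -/
def IsCompletelyIntegrallyClosed : Prop :=
  ∀ T : Submonoid Q, S ≤ T → (∃ a ∈ S, ∃ b ∈ S, ∀ t ∈ T, a * t * b ∈ S) → T = S

/-- `v`-noetherian: every ascending sequence of `v`-ideals becomes stationary. -/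
def IsVNoetherian : Prop :=
  ∀ A : ℕ → Set Q, (∀ n, IsVIdeal S (A n)) → Monotone A → ∃ m, ∀ n, m ≤ n → A n = A m

end Ideals

/-! ### Krull monoids, divisor homomorphisms, divisor theories -/

section Main

/-- Krull monoids: completely integrally closed and `v`-noetherian (as submonoids of `q(H)`). -/
def IsKrull (H : Type u) [CancelMonoid H] [IsOre H] : Prop :=
  IsCompletelyIntegrallyClosed (inQ H) ∧ IsVNoetherian (inQ H)

/-- Normalizing: `aH = Ha` for all `a ∈ H`. -/
def IsNormalizing (H : Type u) [Monoid H] : Prop :=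
  ∀ a : H, Set.range (fun h : H => a * h) = Set.range (fun h : H => h * a)

/-- Left divisibility `a ∣ₗ b`: `b ∈ aH`. -/
def LeftDvd {H : Type u} [Monoid H] (a b : H) : Prop := ∃ c, b = a * c

/-- Right divisibility `a ∣ᵣ b`: `b ∈ Ha`. -/
def RightDvd {H : Type u} [Monoid H] (a b : H) : Prop := ∃ c, b = c * a

/-- (Left and right) divisor homomorphisms. -/
def IsDivisorHom {H : Type u} {D : Type v} [Monoid H] [Monoid D] (φ : H →* D) : Prop :=
  (∀ a b : H, LeftDvd (φ a) (φ b) → LeftDvd a b) ∧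
    ∀ a b : H, RightDvd (φ a) (φ b) → RightDvd a b

/-- The free abelian monoid `F(P)` with basis `P`, written multiplicatively. -/
abbrev FreeAbMonoid (P : Type u) : Type u := Multiplicative (P →₀ ℕ)

/-- `D = F(P)`: the monoid `D` is free abelian with basis `P ⊆ D`, that is, the inclusion `P → D`
extends to an isomorphism `F(P) → D`. -/
def IsFreeAbelianOn {D : Type u} [Monoid D] (P : Set D) : Prop :=
  ∃ e : FreeAbMonoid P ≃* D, ∀ p : P, e (Multiplicative.ofAdd (Finsupp.single p 1)) = p

/-- `d` is a greatest common divisor of `Y` (in a commutative monoid `D`; if `D` is moreover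
reduced, then it is the only one). -/
def IsGCD {D : Type u} [Monoid D] (Y : Set D) (d : D) : Prop :=
  (∀ y ∈ Y, d ∣ y) ∧ ∀ c : D, (∀ y ∈ Y, c ∣ y) → c ∣ d

/-- Divisor theories: divisor homomorphisms `φ : H → D = F(P)` such that every `p ∈ P` is the
greatest common divisor of `φ(X)` for some finite non-empty `X ⊆ H`. -/
def IsDivisorTheory {H : Type u} {D : Type v} [Monoid H] [Monoid D] (φ : H →* D) : Prop :=
  IsDivisorHom φ ∧ ∃ P : Set D, IsFreeAbelianOn P ∧
    ∀ p ∈ P, ∃ X : Finset H, X.Nonempty ∧ IsGCD (φ '' (X : Set H)) p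

/-- The set `I_v^*(H)` is defined, `a ↦ aH` is a map (and a homomorphism) from `H` to `I_v^*(H)`,
and it is a divisor theory. -/
def PrincipalMapIsDivisorTheory (H : Type u) [CancelMonoid H] [IsOre H] : Prop :=
  ∃ hS : SymmetricQuotients (inQ H), ∃ δ : H →* IvStar (inQ H) hS,
    (∀ a : H, (δ a).carrier = {x | ∃ h : H, x = toQ H a * toQ H h}) ∧ IsDivisorTheory δ

end Main

end KrullMonoid

namespace KrullMonoid

/-! ### Free abelian monoids -/

section Free

variable {M : Type u}

/-! For (d) ⇒ (a): if `aH = Ha` for all `a`, then `H` is invariant under conjugation in `q(H)`, so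
`xy ∈ H` implies `yx ∈ H`. Left and right quotients then agree, and ideal theory runs as in the
commutative case. Complete integral closedness makes every non-empty `v`-ideal `v`-invertible, so
that in `I_v^*` containing means dividing (`IvStar.dvd_iff_subset`). The chain condition factors
every element into maximal ones. Distinct maximal elements satisfy `P ∩ R = (PR)_v`
(`IvStar.inter_eq_mul`), hence commute and are prime to each other, and `I_v^*` is free abelian on
them. Each is the `v`-closure of a finite set, which exhibits it as a gcd of principal ideals.

For (c) ⇒ (d): divisibility in `F(P)` is two-sided, which forces `aH = Ha`. The homomorphism extends
to `q(H)` with values in `ℤ^(P)`, and `H` consists of the elements with non-negative values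
(`IsDivisorHom.exists_valuations`). Values of powers give complete integral closedness. A non-empty
`v`-ideal is determined by its componentwise minimal values, which gives the chain condition. The
implications (a) ⇒ (b) ⇒ (c) are formal. -/

theorem dvd_multiset_prod_imp_mem [CommMonoid M] {P : Set M} (h1 : ∀ p ∈ P, ¬ p ∣ 1)
    (h2 : ∀ p ∈ P, ∀ q ∈ P, p ≠ q → ∀ b, p ∣ q * b → p ∣ b) (p : P) (s : Multiset P)
    (h : (p : M) ∣ (s.map (fun x : P => (x : M))).prod) : p ∈ s := by
  induction s using Multiset.induction with
  | empty => exact absurd (by simpa using h) (h1 p p.2)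
  | cons q s ih =>
    rw [Multiset.mem_cons]
    by_cases hpq : p = q
    · exact Or.inl hpq
    · refine Or.inr (ih (h2 p p.2 q q.2 (fun h => hpq (Subtype.ext h)) _ ?_))
      simpa using h

/-- A factor `p` of one product divides the other, so it occurs there by
`dvd_multiset_prod_imp_mem`; cancel it and induct. -/
theorem multiset_prod_injective [CommMonoid M] [IsCancelMul M] {P : Set M}
    (h1 : ∀ p ∈ P, ¬ p ∣ 1)
    (h2 : ∀ p ∈ P, ∀ q ∈ P, p ≠ q → ∀ b, p ∣ q * b → p ∣ b) :
    Function.Injective (fun s : Multiset P => (s.map (fun x : P => (x : M))).prod) := by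
  intro s
  induction s using Multiset.induction with
  | empty =>
    intro t h
    by_contra hne
    obtain ⟨p, hp⟩ := Multiset.exists_mem_of_ne_zero (Ne.symm hne)
    apply h1 p p.2
    have h' : (1 : M) = (t.map (fun x : P => (x : M))).prod := by simpa using h
    rw [h']
    exact Multiset.dvd_prod (Multiset.mem_map_of_mem _ hp)
  | cons p s ih =>
    intro t h
    have hp : p ∈ t := by
      refine dvd_multiset_prod_imp_mem h1 h2 p t ?_
      rw [← show _ = (t.map (fun x : P => (x : M))).prod from h]
      exact Multiset.dvd_prod (Multiset.mem_map_of_mem _ (Multiset.mem_cons_self p s))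
    obtain ⟨t, rfl⟩ := Multiset.exists_cons_of_mem hp
    simp only [Multiset.map_cons, Multiset.prod_cons, mul_right_inj] at h
    rw [ih h]

/-- A cancellative commutative monoid generated by a set of non-units which are prime to each
other is free abelian on this set. -/
theorem isFreeAbelianOn_of_closure_eq_top [CommMonoid M] [IsCancelMul M] {P : Set M}
    (hP : Submonoid.closure P = ⊤) (h1 : ∀ p ∈ P, ¬ p ∣ 1)
    (h2 : ∀ p ∈ P, ∀ q ∈ P, p ≠ q → ∀ b, p ∣ q * b → p ∣ b) : IsFreeAbelianOn P := by
  let g : FreeAbMonoid P →* M :=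
    { toFun := fun m => ((Finsupp.toMultiset m.toAdd).map (fun x : P => (x : M))).prod
      map_one' := by simp
      map_mul' := fun m n => by simp }
  have hg : ∀ p : P, g (Multiplicative.ofAdd (Finsupp.single p 1)) = p := fun p => by
    simp [g]
  refine ⟨MulEquiv.ofBijective g ⟨?_, ?_⟩, hg⟩
  · intro m n h
    classical
    exact Multiplicative.toAdd.injective
      (Multiset.toFinsupp.symm.injective (multiset_prod_injective h1 h2 h))
  · rw [← MonoidHom.mrange_eq_top, eq_top_iff, ← hP, Submonoid.closure_le]
    intro p hp
    exact ⟨_, hg ⟨p, hp⟩⟩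

/-- Commuting generators make the whole monoid commutative. This form serves `I_v^*`, whose
commutativity is not known beforehand. -/
theorem isFreeAbelianOn_of_commute [Monoid M] [IsCancelMul M] {P : Set M}
    (hP : Submonoid.closure P = ⊤) (hcomm : ∀ p ∈ P, ∀ q ∈ P, p * q = q * p)
    (h1 : ∀ p ∈ P, ¬ p ∣ 1)
    (h2 : ∀ p ∈ P, ∀ q ∈ P, p ≠ q → ∀ b, p ∣ q * b → p ∣ b) : IsFreeAbelianOn P := by
  have key : ∀ a b : M, a * b = b * a := fun a b => by
    have hc := Submonoid.isMulCommutative_closure _ hcomm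
    have ha : a ∈ Submonoid.closure P := hP ▸ Submonoid.mem_top a
    have hb : b ∈ Submonoid.closure P := hP ▸ Submonoid.mem_top b
    exact congrArg Subtype.val (hc.is_comm.comm ⟨a, ha⟩ ⟨b, hb⟩)
  let _ : CommMonoid M := { ‹Monoid M› with mul_comm := key }
  exact isFreeAbelianOn_of_closure_eq_top hP h1 h2

end Free

/-! ### Conjugation invariant submonoids -/

section Normal

variable {Q : Type u} [Group Q] {S : Submonoid Q}

variable (S) in
/-- `S` is invariant under conjugation. -/
def SwapInvariant : Prop := ∀ x y : Q, x * y ∈ S → y * x ∈ S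

theorem SwapInvariant.lquot_eq_rquot (hN : SwapInvariant S) (C : Set Q) :
    lquot (S : Set Q) C = rquot S C :=
  Set.ext fun _ => ⟨fun h c hc => hN _ _ (h c hc), fun h c hc => hN _ _ (h c hc)⟩

theorem SwapInvariant.symmetricQuotients (hN : SwapInvariant S) : SymmetricQuotients S :=
  fun C _ => hN.lquot_eq_rquot C

theorem SwapInvariant.isVIdeal (hN : SwapInvariant S) {A : Set Q} (hA : A ⊆ S)
    (hv : vclosure S A = A) : IsVIdeal S A := by
  refine ⟨isIdeal_of hA ?_ ?_, hv, ?_⟩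
  · intro s hs a ha
    rw [← hv] at ha ⊢
    intro y hy
    rw [mul_assoc]
    exact S.mul_mem hs (ha y hy)
  · intro s hs a ha
    rw [← hv] at ha ⊢
    intro y hy
    refine hN _ _ ?_
    rw [← mul_assoc]
    exact S.mul_mem (hN _ _ (ha y hy)) hs
  · rw [hN.lquot_eq_rquot, ← hN.lquot_eq_rquot]
    exact hv

theorem vclosure_mono {A B : Set Q} (h : A ⊆ B) : vclosure S A ⊆ vclosure S B :=
  fun _ hx y hy => hx y fun a ha => hy a (h ha)

theorem SwapInvariant.isVIdeal_vclosure (hN : SwapInvariant S) {A : Set Q} (hA : A ⊆ S) :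
    IsVIdeal S (vclosure S A) :=
  hN.isVIdeal (vclosure_subset hA) (vclosure_vclosure A)

theorem SwapInvariant.isVIdeal_inter (hN : SwapInvariant S) {A B : Set Q} (hA : IsVIdeal S A)
    (hB : IsVIdeal S B) : IsVIdeal S (A ∩ B) := by
  refine hN.isVIdeal (fun x hx => hA.isIdeal.2 hx.1) (Set.Subset.antisymm ?_ (subset_vclosure _))
  refine Set.subset_inter ?_ ?_
  · exact (vclosure_mono Set.inter_subset_left).trans hA.left_divisorial.subset
  · exact (vclosure_mono Set.inter_subset_right).trans hB.left_divisorial.subset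

/-- If `AA⁻¹x ⊆ S`, then `A⁻¹x ⊆ A⁻¹`; if `A⁻¹Ax ⊆ S`, then `Ax ⊆ (A⁻¹)⁻¹ = A`. In both cases `x`
lies in a multiplier monoid `T ⊇ S` with `aT ⊆ S` for any `a ∈ A`, and such a `T` equals `S`. -/
theorem isVInvertible_of_isCompletelyIntegrallyClosed (hN : SwapInvariant S)
    (hC : IsCompletelyIntegrallyClosed S) {A : Set Q} (hA : IsVIdeal S A) (hne : A.Nonempty) :
    IsVInvertible S A := by
  have hS := hN.symmetricQuotients
  obtain ⟨a, ha⟩ := hne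
  constructor
  · rw [vclosure_eq_self_iff (mul_lquot_subset hS hA.isIdeal)]
    let T : Submonoid Q :=
      { carrier := {t | ∀ x ∈ lquot (S : Set Q) A, x * t ∈ lquot (S : Set Q) A}
        one_mem' := fun x hx => by simpa using hx
        mul_mem' := fun {s t} hs ht x hx => by rw [← mul_assoc]; exact ht _ (hs x hx) }
    have hT : T = S := by
      refine hC T ?_ ⟨a, hA.isIdeal.2 ha, 1, S.one_mem, ?_⟩
      · intro s hs x hx b hb
        rw [mul_assoc]
        exact hx _ (hA.isIdeal.mul_mem_left hs hb)
      · intro t ht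
        have h1 : (1 : Q) ∈ lquot (S : Set Q) A := fun b hb => by
          simpa using hA.isIdeal.2 hb
        have h2 := ht 1 h1
        rw [hN.lquot_eq_rquot, one_mul] at h2
        simpa using h2 a ha
    intro x hx
    rw [SetLike.mem_coe, ← hT]
    intro y hy
    rw [hN.lquot_eq_rquot]
    intro b hb
    rw [← mul_assoc]
    exact hx _ ⟨b, hb, y, hy, rfl⟩
  · rw [vclosure_eq_self_iff (lquot_mul_subset A)]
    let T : Submonoid Q :=
      { carrier := {t | ∀ x ∈ A, x * t ∈ A}
        one_mem' := fun x hx => by simpa using hx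
        mul_mem' := fun {s t} hs ht x hx => by rw [← mul_assoc]; exact ht _ (hs x hx) }
    have hT : T = S := by
      refine hC T ?_ ⟨a, hA.isIdeal.2 ha, 1, S.one_mem, ?_⟩
      · intro s hs x hx
        exact hA.isIdeal.mul_mem_right hx hs
      · intro t ht
        simpa using hA.isIdeal.2 (ht a ha)
    intro x hx
    rw [SetLike.mem_coe, ← hT]
    intro b hb
    rw [← hA.right_divisorial]
    intro y hy
    rw [← mul_assoc]
    exact hx _ ⟨y, hy, b, hb, rfl⟩

/-! ### Cancellation, divisibility and maximal elements in `I_v^*` -/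

namespace IvStar

variable {hS : SymmetricQuotients S}

theorem nonempty (A : IvStar S hS) : A.carrier.Nonempty :=
  A.isVInvertible.nonempty A.isVIdeal

theorem carrier_one : (1 : IvStar S hS).carrier = S := rfl

theorem carrier_subset (A : IvStar S hS) : A.carrier ⊆ S := A.isVIdeal.isIdeal.2

theorem carrier_mul_subset_left (A B : IvStar S hS) : (A * B).carrier ⊆ A.carrier := by
  refine (vclosure_mono ?_).trans A.isVIdeal.left_divisorial.subset
  rintro _ ⟨a, ha, b, hb, rfl⟩
  exact A.isVIdeal.isIdeal.mul_mem_right ha (B.carrier_subset hb)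

theorem carrier_mul_subset_right (A B : IvStar S hS) : (A * B).carrier ⊆ B.carrier := by
  refine (vclosure_mono ?_).trans B.isVIdeal.left_divisorial.subset
  rintro _ ⟨a, ha, b, hb, rfl⟩
  exact B.isVIdeal.isIdeal.mul_mem_left (A.carrier_subset ha) hb

theorem carrier_subset_of_dvd {A B : IvStar S hS} (h : A ∣ B) : B.carrier ⊆ A.carrier := by
  obtain ⟨C, rfl⟩ := h
  exact carrier_mul_subset_left A C

/-- The working form of `(AA⁻¹)_v = S`: membership in `S` may be tested after multiplication by
`AA⁻¹`. -/
theorem mem_of_rquot_mul_lquot (A : IvStar S hS) {x : Q}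
    (h : ∀ a ∈ A.carrier, ∀ y ∈ lquot (S : Set Q) A.carrier, a * y * x ∈ S) : x ∈ S := by
  refine (vclosure_eq_self_iff (mul_lquot_subset hS A.isVIdeal.isIdeal)).1 A.isVInvertible.1 ?_
  rintro _ ⟨a, ha, y, hy, rfl⟩
  exact h a ha y hy

theorem mem_of_rquot_lquot_mul (A : IvStar S hS) {x : Q}
    (h : ∀ a ∈ A.carrier, ∀ y ∈ lquot (S : Set Q) A.carrier, y * a * x ∈ S) : x ∈ S := by
  refine (vclosure_eq_self_iff (lquot_mul_subset A.carrier)).1 A.isVInvertible.2 ?_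
  rintro _ ⟨y, hy, a, ha, rfl⟩
  exact h a ha y hy

/-- For `y ∈ C⁻¹` and `x ∈ A⁻¹` the product `yx` lies in `(AC)⁻¹`. Hence `ab ∈ (AC)_v` gives `abyx ∈
S`, so `xa(by) ∈ S` after a swap, and `(A⁻¹A)_v = S` yields `by ∈ S`. -/
theorem subset_of_mul_subset_mul_left (hN : SwapInvariant S) {A B C : IvStar S hS}
    (h : (A * B).carrier ⊆ (A * C).carrier) : B.carrier ⊆ C.carrier := by
  intro b hb
  rw [← C.isVIdeal.left_divisorial]
  intro y hy
  refine A.mem_of_rquot_lquot_mul fun a ha x hx => ?_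
  have hz : a * b ∈ (A * C).carrier := h (subset_vclosure _ ⟨a, ha, b, hb, rfl⟩)
  have hyx : y * x ∈ rquot (S : Set Q) (A.carrier * C.carrier) := by
    rintro _ ⟨a', ha', c, hc, rfl⟩
    have h3 : x * (a' * c * y) ∈ S := by simpa [mul_assoc] using S.mul_mem (hx a' ha') (hy c hc)
    simpa [mul_assoc] using hN _ _ h3
  have h4 : (a * b * y) * x ∈ S := by simpa [mul_assoc] using hz _ hyx
  simpa [mul_assoc] using hN _ _ h4

theorem subset_of_mul_subset_mul_right (hN : SwapInvariant S) {A B C : IvStar S hS}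
    (h : (B * A).carrier ⊆ (C * A).carrier) : B.carrier ⊆ C.carrier := by
  intro b hb
  rw [← C.isVIdeal.left_divisorial]
  intro y hy
  refine hN _ _ (A.mem_of_rquot_mul_lquot fun a ha x hx => ?_)
  have hz : b * a ∈ (C * A).carrier := h (subset_vclosure _ ⟨b, hb, a, ha, rfl⟩)
  have hax : a * x ∈ S := hN _ _ (hx a ha)
  have hxy : x * y ∈ rquot (S : Set Q) (C.carrier * A.carrier) := by
    rintro _ ⟨c, hc, a', ha', rfl⟩
    have h3 : y * (c * a' * x) ∈ S := by
      simpa [mul_assoc] using S.mul_mem (hN _ _ (hy c hc)) (hN _ _ (hx a' ha'))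
    simpa [mul_assoc] using hN _ _ h3
  have h4 : b * (a * x * y) ∈ S := by simpa [mul_assoc] using hz _ hxy
  simpa [mul_assoc] using hN _ _ h4

theorem isCancelMul (hN : SwapInvariant S) : IsCancelMul (IvStar S hS) where
  mul_left_cancel A B C h := by
    have h' : (A * B).carrier = (A * C).carrier := congrArg carrier h
    exact IvStar.ext (Set.Subset.antisymm (subset_of_mul_subset_mul_left hN h'.subset)
      (subset_of_mul_subset_mul_left hN h'.superset))
  mul_right_cancel A B C h := by
    have h' : (B * A).carrier = (C * A).carrier := congrArg carrier h
    exact IvStar.ext (Set.Subset.antisymm (subset_of_mul_subset_mul_right hN h'.subset)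
      (subset_of_mul_subset_mul_right hN h'.superset))

/-- When `A ⊆ B`, the cofactor is `(B⁻¹A)_v`: it lies in `S` because `B⁻¹A ⊆ B⁻¹B ⊆ S`, it is
`v`-invertible by complete integral closedness, and `(BB⁻¹)_v = S` recovers `A`. -/
theorem dvd_iff_subset (hN : SwapInvariant S) (hC : IsCompletelyIntegrallyClosed S)
    {A B : IvStar S hS} : B ∣ A ↔ A.carrier ⊆ B.carrier := by
  refine ⟨carrier_subset_of_dvd, fun h => ?_⟩
  have hsub : lquot (S : Set Q) B.carrier * A.carrier ⊆ S := by
    rintro _ ⟨x, hx, a, ha, rfl⟩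
    exact hx a (h ha)
  have hV := hN.isVIdeal_vclosure hsub
  have h1 : (1 : Q) ∈ lquot (S : Set Q) B.carrier := fun b hb => by
    simpa using B.carrier_subset hb
  have hne : (vclosure S (lquot (S : Set Q) B.carrier * A.carrier)).Nonempty :=
    (Set.Nonempty.mul ⟨1, h1⟩ A.nonempty).mono (subset_vclosure _)
  refine ⟨⟨_, hV, isVInvertible_of_isCompletelyIntegrallyClosed hN hC hV hne⟩,
    IvStar.ext (A.isVIdeal.left_divisorial.symm.trans (vclosure_eq_of_rquot_eq ?_))⟩
  apply Set.Subset.antisymm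
  · rintro y hy _ ⟨b, hb, c, hc, rfl⟩
    have hyb : y * b ∈ rquot (S : Set Q) (lquot (S : Set Q) B.carrier * A.carrier) := by
      rintro _ ⟨x, hx, a, ha, rfl⟩
      have h3 : (a * y * b) * x ∈ S := by
        simpa [mul_assoc] using S.mul_mem (hy a ha) (hN _ _ (hx b hb))
      simpa [mul_assoc] using hN _ _ h3
    have h4 : (c * y) * b ∈ S := by simpa [mul_assoc] using hc _ hyb
    simpa [mul_assoc] using hN _ _ h4
  · intro y hy a ha
    refine B.mem_of_rquot_mul_lquot fun b hb x hx => ?_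
    have := hy _ ⟨b, hb, x * a, subset_vclosure _ ⟨x, hx, a, ha, rfl⟩, rfl⟩
    simpa [mul_assoc] using this

/-- The maximal elements among the proper `v`-invertible `v`-ideals. -/
def IsMaximal (P : IvStar S hS) : Prop :=
  P.carrier ≠ S ∧ ∀ B : IvStar S hS, P.carrier ⊆ B.carrier → B = P ∨ B = 1

/-- Write `P ∩ R = (PX)_v`. Cancelling `P` in `PR ⊆ PX` gives `R ⊆ X`, so `X = R` or `X = 1`; the
latter means `P ⊆ R`, against maximality of two distinct proper elements. -/
theorem inter_eq_mul (hN : SwapInvariant S) (hC : IsCompletelyIntegrallyClosed S)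
    {P R : IvStar S hS} (hP : P.IsMaximal) (hR : R.IsMaximal) (hPR : P ≠ R) :
    P.carrier ∩ R.carrier = (P * R).carrier := by
  have hsub : (P * R).carrier ⊆ P.carrier ∩ R.carrier :=
    Set.subset_inter (carrier_mul_subset_left P R) (carrier_mul_subset_right P R)
  have hV := hN.isVIdeal_inter P.isVIdeal R.isVIdeal
  let I : IvStar S hS := ⟨_, hV, isVInvertible_of_isCompletelyIntegrallyClosed hN hC hV
    ((P * R).nonempty.mono hsub)⟩
  obtain ⟨X, hX⟩ : P ∣ I := (dvd_iff_subset hN hC).2 Set.inter_subset_left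
  have hRX : R.carrier ⊆ X.carrier := by
    apply subset_of_mul_subset_mul_left hN (A := P)
    rw [← hX]
    exact hsub
  rcases hR.2 X hRX with rfl | rfl
  · exact congrArg carrier hX
  · rw [mul_one] at hX
    have hPsub : P.carrier ⊆ R.carrier := by
      rw [← hX]
      exact Set.inter_subset_right
    rcases hP.2 R hPsub with h | h
    · exact absurd h.symm hPR
    · exact absurd (congrArg carrier h) hR.1

end IvStar

/-! ### Consequences of the ascending chain condition: factorization and finite generation -/

theorem wellFoundedGT_isVIdeal (hV : IsVNoetherian S) :
    WellFoundedGT {A : Set Q // IsVIdeal S A} := by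
  rw [wellFoundedGT_iff_monotone_chain_condition]
  intro f
  obtain ⟨m, hm⟩ := hV (fun n => (f n).1) (fun n => (f n).2) (fun i j h => f.monotone h)
  exact ⟨m, fun n hn => Subtype.ext (hm n hn).symm⟩

theorem exists_maximal_isVIdeal (hV : IsVNoetherian S) (p : Set Q → Prop)
    (hp : ∃ A, IsVIdeal S A ∧ p A) :
    ∃ A, IsVIdeal S A ∧ p A ∧ ∀ B, IsVIdeal S B → p B → A ⊆ B → B = A := by
  have := wellFoundedGT_isVIdeal hV
  obtain ⟨A, hA, hpA⟩ := hp
  obtain ⟨M, hM⟩ := exists_maximal_of_wellFoundedGT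
    (fun A : {A : Set Q // IsVIdeal S A} => p A.1) ⟨⟨A, hA⟩, hpA⟩
  exact ⟨M.1, M.2, hM.1, fun B hB hpB h =>
    Set.Subset.antisymm (hM.2 (y := ⟨B, hB⟩) hpB h) h⟩

namespace IvStar

variable {hS : SymmetricQuotients S}

theorem exists_isMaximal (hN : SwapInvariant S) (hC : IsCompletelyIntegrallyClosed S)
    (hV : IsVNoetherian S) (A : IvStar S hS) (hA : A ≠ 1) :
    ∃ P : IvStar S hS, P.IsMaximal ∧ A.carrier ⊆ P.carrier := by
  obtain ⟨P, hP, ⟨hPS, hAP⟩, hmax⟩ := exists_maximal_isVIdeal hV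
    (fun B => B ≠ S ∧ A.carrier ⊆ B) ⟨A.carrier, A.isVIdeal, fun h => hA (IvStar.ext h), subset_rfl⟩
  refine ⟨⟨P, hP, isVInvertible_of_isCompletelyIntegrallyClosed hN hC hP (A.nonempty.mono hAP)⟩,
    ⟨hPS, fun B hB => ?_⟩, hAP⟩
  by_cases h : B.carrier = S
  · exact Or.inr (IvStar.ext h)
  · exact Or.inl (IvStar.ext (hmax _ B.isVIdeal ⟨h, hAP.trans hB⟩ hB))

/-- Noetherian induction: a largest element that is not a product of maximal ones factors as `PB`
with `P` maximal and `PB ⊆ B`. Then `B` is no such product either, so `B = PB`, and cancelling `B`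
gives `P = 1`. -/
theorem closure_isMaximal (hN : SwapInvariant S) (hC : IsCompletelyIntegrallyClosed S)
    (hV : IsVNoetherian S) :
    Submonoid.closure {P : IvStar S hS | P.IsMaximal} = ⊤ := by
  have := isCancelMul (hS := hS) hN
  by_contra hne
  obtain ⟨A, hA, ⟨hAi, hAm⟩, hmax⟩ := exists_maximal_isVIdeal hV
    (fun B => ∃ C : IvStar S hS, C.carrier = B ∧
      C ∉ Submonoid.closure {P : IvStar S hS | P.IsMaximal}) (by
        rw [Submonoid.eq_top_iff'] at hne
        push Not at hne
        obtain ⟨C, hC'⟩ := hne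
        exact ⟨C.carrier, C.isVIdeal, C, rfl, hC'⟩)
  obtain ⟨rfl, hAm⟩ := hAm
  have hA1 : hAi ≠ 1 := fun h => hAm (h ▸ Submonoid.one_mem _)
  obtain ⟨P, hP, hAP⟩ := exists_isMaximal hN hC hV hAi hA1
  obtain ⟨B, rfl⟩ := (dvd_iff_subset hN hC).2 hAP
  by_cases hB : B ∈ Submonoid.closure {P : IvStar S hS | P.IsMaximal}
  · exact hAm (Submonoid.mul_mem _ (Submonoid.subset_closure hP) hB)
  · have h := hmax B.carrier B.isVIdeal ⟨B, rfl, hB⟩ (carrier_mul_subset_right P B)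
    have h' : 1 * B = P * B := (one_mul B).trans (IvStar.ext h)
    exact hP.1 (congrArg carrier (mul_right_cancel h')).symm

theorem isFreeAbelianOn_isMaximal (hN : SwapInvariant S) (hC : IsCompletelyIntegrallyClosed S)
    (hV : IsVNoetherian S) : IsFreeAbelianOn {P : IvStar S hS | P.IsMaximal} := by
  have := isCancelMul (hS := hS) hN
  refine isFreeAbelianOn_of_commute (closure_isMaximal hN hC hV) ?_ ?_ ?_
  · intro P hP R hR
    by_cases h : P = R
    · rw [h]
    · apply IvStar.ext
      rw [← inter_eq_mul hN hC hP hR h, ← inter_eq_mul hN hC hR hP (Ne.symm h), Set.inter_comm]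
  · intro P hP h
    exact hP.1 (Set.Subset.antisymm P.carrier_subset (carrier_subset_of_dvd h))
  · intro P hP R hR hPR B h
    rw [dvd_iff_subset hN hC] at h ⊢
    -- `RB ⊆ P` gives `RB ⊆ R ∩ P = RP`, from which `R` cancels.
    apply subset_of_mul_subset_mul_left hN (A := R)
    rw [← inter_eq_mul hN hC hR hP (Ne.symm hPR)]
    exact Set.subset_inter (carrier_mul_subset_left R B) h

end IvStar

/-- Among the `v`-closures of finite non-empty subsets of `A` there is a maximal one; adjoining any
`b ∈ A` cannot enlarge it, so it is all of `A`. -/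
theorem exists_finite_vclosure_eq (hN : SwapInvariant S) (hV : IsVNoetherian S) {A : Set Q}
    (hA : IsVIdeal S A) (hne : A.Nonempty) :
    ∃ X : Set Q, X.Finite ∧ X.Nonempty ∧ X ⊆ A ∧ vclosure S X = A := by
  obtain ⟨a, ha⟩ := hne
  have hsub : ∀ {X : Set Q}, X ⊆ A → vclosure S X ⊆ A := fun h =>
    (vclosure_mono h).trans hA.left_divisorial.subset
  obtain ⟨B, -, ⟨X, hXf, hXn, hXA, rfl⟩, hmax⟩ := exists_maximal_isVIdeal hV
    (fun B => ∃ X : Set Q, X.Finite ∧ X.Nonempty ∧ X ⊆ A ∧ vclosure S X = B)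
    ⟨_, hN.isVIdeal_vclosure (Set.singleton_subset_iff.2 (hA.isIdeal.2 ha)), {a},
      Set.finite_singleton a, Set.singleton_nonempty a, Set.singleton_subset_iff.2 ha, rfl⟩
  refine ⟨X, hXf, hXn, hXA, Set.Subset.antisymm (hsub hXA) fun b hb => ?_⟩
  have hbX : insert b X ⊆ A := Set.insert_subset hb hXA
  rw [← hmax (vclosure S (insert b X)) (hN.isVIdeal_vclosure (hbX.trans hA.isIdeal.2))
    ⟨_, hXf.insert b, Set.insert_nonempty b X, hbX, rfl⟩ (vclosure_mono (Set.subset_insert b X))]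
  exact subset_vclosure _ (Set.mem_insert b X)

end Normal

/-! ### Principal ideals of a normalizing monoid -/

section Main

variable {H : Type u} [CancelMonoid H] [IsOre H]

theorem toQ_mem_inQ (a : H) : toQ H a ∈ inQ H := ⟨a, rfl⟩

theorem IsNormalizing.swapInvariant (hH : IsNormalizing H) : SwapInvariant (inQ H) := by
  have h1 : ∀ a : H, ∀ s ∈ inQ H, toQ H a * s * (toQ H a)⁻¹ ∈ inQ H := by
    rintro a _ ⟨h, rfl⟩
    obtain ⟨k, hk⟩ : a * h ∈ Set.range (fun h : H => h * a) := hH a ▸ ⟨h, rfl⟩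
    refine ⟨k, ?_⟩
    rw [← map_mul, ← show k * a = a * h from hk, map_mul, mul_inv_cancel_right]
  have h2 : ∀ a : H, ∀ s ∈ inQ H, (toQ H a)⁻¹ * s * toQ H a ∈ inQ H := by
    rintro a _ ⟨h, rfl⟩
    obtain ⟨k, hk⟩ : h * a ∈ Set.range (fun h : H => a * h) := (hH a).symm ▸ ⟨h, rfl⟩
    refine ⟨k, ?_⟩
    rw [mul_assoc, ← map_mul, ← show a * k = h * a from hk, map_mul, inv_mul_cancel_left]
  intro x y hxy
  obtain ⟨a, b, rfl⟩ := exists_left_fraction H y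
  -- `yx` is the conjugate of `xy` by `y = a⁻¹b`: conjugate by `b`, then by `a⁻¹`.
  have := h2 a _ (h1 b _ hxy)
  convert this using 1
  group

theorem principal_nonempty (a : H) :
    ({x | ∃ h : H, x = toQ H a * toQ H h} : Set (QuotientGrp H)).Nonempty :=
  ⟨toQ H a * toQ H 1, 1, rfl⟩

theorem principal_subset_inQ (a : H) : {x | ∃ h : H, x = toQ H a * toQ H h} ⊆ (inQ H : Set _) := by
  rintro _ ⟨h, rfl⟩
  exact (inQ H).mul_mem (toQ_mem_inQ a) (toQ_mem_inQ h)

theorem IsNormalizing.vclosure_principal (hH : IsNormalizing H) (a : H) :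
    vclosure (inQ H) {x | ∃ h : H, x = toQ H a * toQ H h} = {x | ∃ h : H, x = toQ H a * toQ H h} := by
  have hN := hH.swapInvariant
  refine Set.Subset.antisymm (fun x hx => ?_) (subset_vclosure _)
  -- One test element of `(aH)⁻¹` suffices: `a⁻¹` forces `xa⁻¹ ∈ H`, hence `a⁻¹x ∈ H`.
  have hy : (toQ H a)⁻¹ ∈ rquot (inQ H : Set (QuotientGrp H)) {x | ∃ h : H, x = toQ H a * toQ H h} := by
    rintro _ ⟨h, rfl⟩
    refine hN _ _ ?_
    rw [inv_mul_cancel_left]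
    exact toQ_mem_inQ h
  obtain ⟨k, hk⟩ := hN _ _ (hx _ hy)
  exact ⟨k, by rw [hk, mul_inv_cancel_left]⟩

/-- The map `a ↦ aH` into the monoid of `v`-invertible `v`-ideals. -/
def principalHom (hH : IsNormalizing H) (hC : IsCompletelyIntegrallyClosed (inQ H))
    (hS : SymmetricQuotients (inQ H)) : H →* IvStar (inQ H) hS where
  toFun a := ⟨{x | ∃ h : H, x = toQ H a * toQ H h},
    hH.swapInvariant.isVIdeal (principal_subset_inQ a) (hH.vclosure_principal a),
    isVInvertible_of_isCompletelyIntegrallyClosed hH.swapInvariant hC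
      (hH.swapInvariant.isVIdeal (principal_subset_inQ a) (hH.vclosure_principal a))
      (principal_nonempty a)⟩
  map_one' := IvStar.ext (Set.ext fun x => by
    simp only [map_one, one_mul, Set.mem_ofPred_eq, IvStar.carrier_one]
    exact ⟨fun ⟨h, hh⟩ => ⟨h, hh.symm⟩, fun ⟨h, hh⟩ => ⟨h, hh.symm⟩⟩)
  map_mul' a b := IvStar.ext (by
    -- As `abH` is its own `v`-closure, the set equality `abH = aH·bH` is enough; `Hb = bH` moves
    -- `b` to the left.
    refine (hH.vclosure_principal (a * b)).symm.trans (congrArg (vclosure (inQ H)) ?_)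
    ext x
    constructor
    · rintro ⟨h, rfl⟩
      exact ⟨toQ H a * toQ H 1, ⟨1, rfl⟩, toQ H b * toQ H h, ⟨h, rfl⟩, by simp [mul_assoc]⟩
    · rintro ⟨_, ⟨h, rfl⟩, _, ⟨k, rfl⟩, rfl⟩
      obtain ⟨l, hl⟩ : h * b ∈ Set.range (fun h : H => b * h) := (hH b).symm ▸ ⟨h, rfl⟩
      refine ⟨l * k, ?_⟩
      show toQ H a * toQ H h * (toQ H b * toQ H k) = _
      simp only [← map_mul]
      rw [mul_assoc a h, ← mul_assoc h b, ← show b * l = h * b from hl]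
      simp only [mul_assoc])

theorem principalHom_carrier (hH : IsNormalizing H) (hC : IsCompletelyIntegrallyClosed (inQ H))
    (hS : SymmetricQuotients (inQ H)) (a : H) :
    (principalHom hH hC hS a).carrier = {x | ∃ h : H, x = toQ H a * toQ H h} := rfl

theorem principalHom_carrier_subset_iff (hH : IsNormalizing H)
    (hC : IsCompletelyIntegrallyClosed (inQ H)) (hS : SymmetricQuotients (inQ H)) {a : H}
    {A : IvStar (inQ H) hS} : (principalHom hH hC hS a).carrier ⊆ A.carrier ↔ toQ H a ∈ A.carrier := by
  rw [principalHom_carrier]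
  constructor
  · intro h
    exact h ⟨1, by simp⟩
  · rintro ha _ ⟨h, rfl⟩
    exact A.isVIdeal.isIdeal.mul_mem_right ha (toQ_mem_inQ h)

theorem isDivisorHom_principalHom (hH : IsNormalizing H)
    (hC : IsCompletelyIntegrallyClosed (inQ H)) (hS : SymmetricQuotients (inQ H)) :
    IsDivisorHom (principalHom hH hC hS) := by
  have key : ∀ a b : H, (principalHom hH hC hS b).carrier ⊆ (principalHom hH hC hS a).carrier →
      ∃ c, b = a * c := fun a b h => by
    obtain ⟨c, hc⟩ := (principalHom_carrier_subset_iff hH hC hS).1 h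
    exact ⟨c, toQ_injective H (by rw [hc, map_mul])⟩
  constructor
  · rintro a b ⟨C, hC'⟩
    exact key a b (hC' ▸ IvStar.carrier_mul_subset_left _ _)
  · rintro a b ⟨C, hC'⟩
    obtain ⟨c, rfl⟩ := key a b (hC' ▸ IvStar.carrier_mul_subset_right _ _)
    obtain ⟨d, hd⟩ : a * c ∈ Set.range (fun h : H => h * a) := hH a ▸ ⟨c, rfl⟩
    exact ⟨d, hd.symm⟩

theorem principalMapIsDivisorTheory_of_isKrull (hH : IsNormalizing H) (hK : IsKrull H) :
    PrincipalMapIsDivisorTheory H := by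
  obtain ⟨hC, hV⟩ := hK
  have hN := hH.swapInvariant
  have hS := hN.symmetricQuotients
  refine ⟨hS, principalHom hH hC hS, principalHom_carrier hH hC hS,
    isDivisorHom_principalHom hH hC hS, _, IvStar.isFreeAbelianOn_isMaximal hN hC hV, ?_⟩
  intro P hP
  -- A common divisor of the ideals `xH`, `x ∈ X`, is a `v`-ideal containing `X`, hence containing
  -- `X_v = P`; so `P` is their gcd.
  obtain ⟨X, hXf, ⟨x, hx⟩, hXP, hXv⟩ := exists_finite_vclosure_eq hN hV P.isVIdeal P.nonempty
  have hXr : X ⊆ Set.range (toQ H) := fun y hy => P.carrier_subset (hXP hy)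
  have hfin : (toQ H ⁻¹' X).Finite := hXf.preimage (toQ_injective H).injOn
  refine ⟨hfin.toFinset, ?_, ?_, ?_⟩
  · obtain ⟨h, rfl⟩ := hXr hx
    exact ⟨h, by simpa using hx⟩
  · rintro _ ⟨h, hh, rfl⟩
    rw [IvStar.dvd_iff_subset hN hC, principalHom_carrier_subset_iff]
    exact hXP (by simpa using hh)
  · intro C hCd
    rw [IvStar.dvd_iff_subset hN hC, ← hXv]
    refine (vclosure_mono ?_).trans C.isVIdeal.left_divisorial.subset
    intro y hy
    obtain ⟨h, rfl⟩ := hXr hy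
    rw [← principalHom_carrier_subset_iff hH hC hS]
    exact IvStar.carrier_subset_of_dvd (hCd _ ⟨h, by simpa using hy, rfl⟩)

/-! ### Divisor homomorphisms into free abelian monoids -/

/-- In a commutative target `φ a` divides `φ (ah)` and `φ (ha)` on both sides, and `φ` reflects each
divisibility. -/
theorem IsDivisorHom.isNormalizing {M : Type u} {D : Type v} [Monoid M] [CommMonoid D]
    {φ : M →* D} (hφ : IsDivisorHom φ) : IsNormalizing M := by
  intro a
  apply Set.Subset.antisymm
  · rintro _ ⟨h, rfl⟩
    obtain ⟨c, hc⟩ := hφ.2 a (a * h) ⟨φ h, by rw [map_mul, mul_comm]⟩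
    exact ⟨c, hc.symm⟩
  · rintro _ ⟨h, rfl⟩
    obtain ⟨c, hc⟩ := hφ.1 a (h * a) ⟨φ h, by rw [map_mul, mul_comm]⟩
    exact ⟨c, hc.symm⟩

theorem exists_quotientGrp_extension {G : Type v} [Group G] (f : H →* G) :
    ∃ g : QuotientGrp H →* G, ∀ a, g (toQ H a) = f a :=
  ⟨OreLocalization.universalMulHom (S := (⊤ : Submonoid H)) f
      ((toUnits.toMonoidHom.comp f).comp (⊤ : Submonoid H).subtype) (fun _ => rfl),
    fun _ => OreLocalization.universalMulHom_commutes _ _ _⟩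

/-- A divisor homomorphism into `F(P)` gives valuations on the quotient group with values in `ℤ`
which define `H` and are almost all zero on each element. -/
theorem IsDivisorHom.exists_valuations {P : Type v} {φ : H →* FreeAbMonoid P}
    (hφ : IsDivisorHom φ) :
    ∃ w : QuotientGrp H → P →₀ ℤ, (∀ x y, w (x * y) = w x + w y) ∧
      ∀ x, x ∈ inQ H ↔ ∀ p, 0 ≤ w x p := by
  let ι : (P →₀ ℕ) →+ (P →₀ ℤ) := Finsupp.mapRange.addMonoidHom (Nat.castAddMonoidHom ℤ)
  obtain ⟨g, hg⟩ := exists_quotientGrp_extension ((AddMonoidHom.toMultiplicative ι).comp φ)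
  have hg' : ∀ a p, (g (toQ H a)).toAdd p = ((φ a).toAdd p : ℤ) := fun a p => by
    rw [hg]; rfl
  refine ⟨fun x => (g x).toAdd, fun x y => by simp only [map_mul, toAdd_mul], fun x => ⟨?_, ?_⟩⟩
  · rintro ⟨a, rfl⟩ p
    rw [hg']
    exact Int.natCast_nonneg _
  · intro hx
    -- For `x = a⁻¹b`, non-negative values mean that `φ a` divides `φ b`; hence `b ∈ aH` and `x ∈
    -- H`.
    obtain ⟨a, b, rfl⟩ := exists_left_fraction H x
    have hle : (φ a).toAdd ≤ (φ b).toAdd := fun p => by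
      have := hx p
      simp only [map_mul, map_inv, toAdd_mul, toAdd_inv, Finsupp.add_apply, Finsupp.neg_apply,
        hg'] at this
      omega
    obtain ⟨d, hd⟩ := exists_add_of_le hle
    obtain ⟨c, rfl⟩ := hφ.1 a b ⟨Multiplicative.ofAdd d, Multiplicative.toAdd.injective hd⟩
    exact ⟨c, by rw [map_mul, inv_mul_cancel_left]⟩

/-! ### Submonoids defined by integer-valued valuations -/

section Valuations

variable {Q : Type u} [Group Q] {S : Submonoid Q} {P : Type v} {w : Q → P →₀ ℤ}

/-- From `a tⁿ b ∈ S` for all `n` it follows that `w a + n • w t + w b ≥ 0`, which a negative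
component of `w t` would violate for large `n`. -/
theorem isCompletelyIntegrallyClosed_of_valuations (hw : ∀ x y, w (x * y) = w x + w y)
    (hS : ∀ x, x ∈ S ↔ ∀ p, 0 ≤ w x p) : IsCompletelyIntegrallyClosed S := by
  rintro T hST ⟨a, -, b, -, hT⟩
  refine le_antisymm (fun t ht => (hS t).2 fun p => ?_) hST
  have hpow : ∀ n : ℕ, w (t ^ n) p = n * w t p := by
    intro n
    induction n with
    | zero =>
      have := DFunLike.congr_fun (hw 1 1) p
      simp only [mul_one, Finsupp.add_apply] at this
      simpa using this
    | succ n ih =>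
      rw [pow_succ, hw, Finsupp.add_apply, ih]
      push_cast
      ring
  by_contra! hlt
  -- Since `w t p ≤ -1`, an exponent of at least `w a p + w b p + 1` makes the total value negative;
  -- `toNat` covers the case of a negative bound.
  have h := (hS _).1 (hT _ (T.pow_mem ht (w a p + w b p + 1).toNat)) p
  rw [hw, hw, Finsupp.add_apply, Finsupp.add_apply, hpow] at h
  have h1 : (w a p + w b p + 1) ≤ ((w a p + w b p + 1).toNat : ℤ) := Int.self_le_toNat _
  have h2 : (0 : ℤ) ≤ ((w a p + w b p + 1).toNat : ℤ) := Int.natCast_nonneg _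
  nlinarith

/-- The componentwise minimum of `w` on `A`. -/
noncomputable def minVal {Q : Type u} (w : Q → P →₀ ℤ) (A : Set Q) (p : P) : ℕ :=
  sInf ((fun a => (w a p).toNat) '' A)

theorem minVal_le {Q : Type u} {w : Q → P →₀ ℤ} {A : Set Q} {a : Q} (ha : a ∈ A)
    (p : P) : minVal w A p ≤ (w a p).toNat :=
  Nat.sInf_le ⟨a, ha, rfl⟩

theorem exists_eq_minVal {Q : Type u} {w : Q → P →₀ ℤ} {A : Set Q} (hA : A.Nonempty) (p : P) :
    ∃ a ∈ A, (w a p).toNat = minVal w A p :=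
  Nat.sInf_mem (hA.image _)

/-- Values on `A ⊆ S` are non-negative, so the truncation in `minVal` loses nothing, and each
minimum is attained. Thus `A⁻¹` depends only on the minima. -/
theorem mem_rquot_iff_minVal (hw : ∀ x y, w (x * y) = w x + w y)
    (hS : ∀ x, x ∈ S ↔ ∀ p, 0 ≤ w x p) {A : Set Q} (hA : A ⊆ S) (hne : A.Nonempty) {x : Q} :
    x ∈ rquot (S : Set Q) A ↔ ∀ p, 0 ≤ minVal w A p + w x p := by
  constructor
  · intro hx p
    obtain ⟨a, ha, h⟩ := exists_eq_minVal (w := w) hne p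
    have h1 := (hS _).1 (hx a ha) p
    have h2 := (hS _).1 (hA ha) p
    rw [hw, Finsupp.add_apply] at h1
    omega
  · intro hx a ha
    refine (hS _).2 fun p => ?_
    have h1 := hx p
    have h2 := (hS _).1 (hA ha) p
    have h3 := minVal_le (w := w) ha p
    rw [hw, Finsupp.add_apply]
    omega

/-- A non-empty `v`-ideal is recovered from its `minVal`, and along an ascending chain these
functions descend in `P →₀ ℕ`, which has no infinite strict descent. -/
theorem isVNoetherian_of_valuations (hw : ∀ x y, w (x * y) = w x + w y)
    (hS : ∀ x, x ∈ S ↔ ∀ p, 0 ≤ w x p) : IsVNoetherian S := by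
  intro A hA hmono
  -- The empty set may be a `v`-ideal and has no meaningful minima, so the chain is shifted past its
  -- empty terms.
  by_cases hne : ∃ k, (A k).Nonempty
  · obtain ⟨k, hk⟩ := hne
    have hkn : ∀ n, (A (n + k)).Nonempty := fun n => hk.mono (hmono (Nat.le_add_left k n))
    obtain ⟨c, hc⟩ := hk
    -- The fixed element `c` lies in all later terms, so every support is contained in that of `w
    -- c`.
    have hsupp : ∀ n, (Function.support (minVal w (A (n + k)))).Finite := fun n =>
      (w c).hasFiniteSupport.subset fun p hp hz => hp (by
        have h1 := minVal_le (w := w) (hmono (Nat.le_add_left k n) hc) p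
        rw [hz] at h1
        simpa using h1)
    let m : ℕ → P →₀ ℕ := fun n => Finsupp.ofSupportFinite _ (hsupp n)
    have hanti : Antitone m := fun i j hij p => by
      obtain ⟨a, ha, h⟩ := exists_eq_minVal (w := w) (hkn i) p
      show minVal w _ p ≤ minVal w _ p
      rw [← h]
      exact minVal_le (hmono (Nat.add_le_add_right hij k) ha) p
    obtain ⟨N, hN⟩ := WellFoundedGT.monotone_chain_condition
      (⟨fun n => OrderDual.toDual (m n), hanti⟩ : ℕ →o (P →₀ ℕ)ᵒᵈ)
    refine ⟨N + k, fun n hn => ?_⟩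
    obtain ⟨i, rfl⟩ : ∃ i, n = i + k := ⟨n - k, by omega⟩
    have hm : minVal w (A (N + k)) = minVal w (A (i + k)) :=
      congrArg (fun f : P →₀ ℕ => (f : P → ℕ)) (hN i (by omega))
    rw [← (hA (i + k)).left_divisorial, ← (hA (N + k)).left_divisorial]
    congr 1
    ext x
    rw [mem_rquot_iff_minVal hw hS (hA _).isIdeal.2 (hkn _),
      mem_rquot_iff_minVal hw hS (hA _).isIdeal.2 (hkn _), hm]
  · push Not at hne
    exact ⟨0, fun n _ => by rw [hne, hne]⟩

end Valuations

theorem IsDivisorHom.isKrull {P : Type v} {φ : H →* FreeAbMonoid P} (hφ : IsDivisorHom φ) :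
    IsKrull H := by
  obtain ⟨w, hw, hS⟩ := hφ.exists_valuations
  exact ⟨isCompletelyIntegrallyClosed_of_valuations hw hS, isVNoetherian_of_valuations hw hS⟩

/-! ### Transport along isomorphisms -/

theorem IsDivisorHom.mulEquiv_comp {M : Type u} {D : Type*} {E : Type*} [Monoid M] [Monoid D]
    [Monoid E] {φ : M →* D} (hφ : IsDivisorHom φ) (e : D ≃* E) :
    IsDivisorHom (e.toMonoidHom.comp φ) := by
  constructor
  · rintro a b ⟨c, hc⟩
    exact hφ.1 a b ⟨e.symm c, e.injective (by simpa using hc)⟩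
  · rintro a b ⟨c, hc⟩
    exact hφ.2 a b ⟨e.symm c, e.injective (by simpa using hc)⟩

theorem IsFreeAbelianOn.image {D : Type u} {E : Type v} [Monoid D] [Monoid E] {P : Set D}
    (hP : IsFreeAbelianOn P) (e : D ≃* E) : IsFreeAbelianOn (e '' P) := by
  obtain ⟨f, hf⟩ := hP
  let σ : (e '' P : Set E) ≃ P := (e.toEquiv.image P).symm
  have hσ : ∀ p, e (σ p) = p := fun p =>
    congrArg Subtype.val ((e.toEquiv.image P).apply_symm_apply p)
  refine ⟨((AddEquiv.toMultiplicative (Finsupp.domCongr σ)).trans f).trans e, fun p => ?_⟩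
  rw [← hσ p, ← hf (σ p)]
  simp [Finsupp.domCongr]

theorem IsGCD.image {D : Type u} {E : Type v} [Monoid D] [Monoid E] {Y : Set D} {d : D}
    (h : IsGCD Y d) (e : D ≃* E) : IsGCD (e '' Y) (e d) := by
  constructor
  · rintro _ ⟨y, hy, rfl⟩
    exact map_dvd e (h.1 y hy)
  · intro c hc
    have := map_dvd e (h.2 (e.symm c) fun y hy => by
      simpa using map_dvd e.symm (hc _ ⟨y, hy, rfl⟩))
    simpa using this

theorem IsDivisorTheory.mulEquiv_comp {M : Type u} {D : Type*} {E : Type*} [Monoid M] [Monoid D]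
    [Monoid E] {φ : M →* D} (hφ : IsDivisorTheory φ) (e : D ≃* E) :
    IsDivisorTheory (e.toMonoidHom.comp φ) := by
  obtain ⟨h, P, hP, hgcd⟩ := hφ
  refine ⟨h.mulEquiv_comp e, e '' P, hP.image e, ?_⟩
  rintro _ ⟨p, hp, rfl⟩
  obtain ⟨X, hX, hXp⟩ := hgcd p hp
  refine ⟨X, hX, ?_⟩
  have := hXp.image e
  rwa [← Set.image_comp] at this

end Main

end KrullMonoid

/-! ### The equivalence of the four statements -/

theorem theorem4p13 (H : Type u) [CancelMonoid H] [KrullMonoid.IsOre H] :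
    List.TFAE
      [ -- (a) the map `a ↦ aH` from `H` to `I_v^*(H)` is a divisor theory
        KrullMonoid.PrincipalMapIsDivisorTheory H,
        -- (b) `H` has a divisor theory
        ∃ (D : Type (max u v)) (_ : Monoid D) (φ : H →* D), KrullMonoid.IsDivisorTheory φ,
        -- (c) there is a divisor homomorphism from `H` into a free abelian monoid
        ∃ (P : Type (max u v)) (φ : H →* KrullMonoid.FreeAbMonoid P), KrullMonoid.IsDivisorHom φ,
        -- (d) `H` is a normalizing Krull monoid
        KrullMonoid.IsNormalizing H ∧ KrullMonoid.IsKrull H ] := by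
  tfae_have 1 → 2 := by
    rintro ⟨hS, δ, -, hδ⟩
    -- `I_v^*(H)` lives in the universe of `H`; `ULift` moves it to `max u v`.
    exact ⟨ULift.{v} (KrullMonoid.IvStar (KrullMonoid.inQ H) hS), inferInstance, _,
      hδ.mulEquiv_comp MulEquiv.ulift.symm⟩
  tfae_have 2 → 3 := by
    rintro ⟨D, _, φ, hφ, P, ⟨e, -⟩, -⟩
    exact ⟨P, _, hφ.mulEquiv_comp e.symm⟩
  tfae_have 3 → 4 := by
    rintro ⟨P, φ, hφ⟩
    exact ⟨hφ.isNormalizing, hφ.isKrull⟩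
  tfae_have 4 → 1 := fun h => KrullMonoid.principalMapIsDivisorTheory_of_isKrull h.1 h.2
  tfae_finish
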